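/- Let $n\ge 1$ and let $T^n=S^1\times\cdots\times S^1=\mathbb{R}^n/\mathbb{Z}^n$ be the $n$-dimensional flat torus with its intrinsic metric $d$, that is, $d([x],[y])=\min_{z\in\mathbb{Z}^n}\|x-y+z\|_2$. The game of Cops and Robber with $k\ge 1$ cops on a compact geodesic space $(X,d)$ is played as follows. The robber first selects initial positions $r^0\in X$ for himself and $c^0=(c^0_1,\dots,c^0_k)\in X^k$ for the cops, and an agility function $\tau:\{1,2,\dots\}\to(0,\infty)$ with $\sum_{m\ge 1}\tau(m)=\infty$; all of this is known to the cops. In step $m\ge 1$ the robber moves to a point $r^m$ with $d(r^{m-1},r^m)\le\tau(m)$; then the cops, knowing $r^m$ and the whole history of the game, move to points $c^m_i$ with $d(c^{m-1}_i,c^m_i)\le\tau(m)$ $(1\le i\le k)$. The cops catch the robber if $c^m_i=r^m$ for some $m\ge 1$ and some $i$. We say that $k$ cops can always catch the robber on $X$ if for every choice of $r^0$, $c^0$ and $\tau$ the cops have a strategy that catches the robber after finitely many steps, however the robber moves. The strong cop number $c_0(X)$ is the minimum $k\ge 1$ such that $k$ cops can always catch the robber on $X$ (and $c_0(X)=\infty$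 if there is no such $k$). **Theorem.** For every $n\ge 1$, $c_0(T^n)=n+1$. That is, $n+1$ cops can always catch the robber on $T^n$, and no smaller number of cops can. -/

import Mathlib

open Filter

namespace CopsRobber

/-- An agility function: `τ n` is the duration of the `(n+1)`-st step of the game (the step that
leads from the `n`-th to the `(n+1)`-st position). The step lengths are positive and their sum
is infinite. -/
structure IsAgility (τ : ℕ → ℝ) : Prop where
  pos : ∀ n, 0 < τ n
  tendsto_sum : Tendsto (fun N => ∑ n ∈ Finset.range N, τ n) atTop atTop

/-- A strategy of `k` cops on `X` for the game with agility `τ`. In the `(n+1)`-st step the cops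
know the positions `r 0, …, r (n+1)` of the robber (who has just moved to `r (n+1)`) and their own
positions `c 0, …, c n`; the strategy returns their new positions. Every cop moves
by at most `τ n`. -/
structure CopStrategy (X : Type*) [MetricSpace X] (k : ℕ) (τ : ℕ → ℝ) where
  move (n : ℕ) (r : Fin (n + 2) → X) (c : Fin (n + 1) → Fin k → X) : Fin k → X
  dist_move_le (n : ℕ) (r : Fin (n + 2) → X) (c : Fin (n + 1) → Fin k → X) (i : Fin k) :
    dist (c (Fin.last n) i) (move n r c i) ≤ τ n

/-- The robber's positions `r` and the cops' positions `c` form a play of the game with agility `τ`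
in which the robber makes legal moves and the cops use the strategy `q`. -/
structure IsPlay {X : Type*} [MetricSpace X] {k : ℕ} {τ : ℕ → ℝ} (q : CopStrategy X k τ)
    (r : ℕ → X) (c : ℕ → Fin k → X) : Prop where
  robber_legal : ∀ n, dist (r n) (r (n + 1)) ≤ τ n
  cops_follow : ∀ n, c (n + 1) =
    q.move n (fun j : Fin (n + 2) => r j) (fun j : Fin (n + 1) => c j)

/-- `k` cops can always catch the robber on `X`: whatever agility function and initial positions
the robber selects, the cops have a strategy such that, however the robber moves, after finitely
many steps some cop is exactly at the robber's position. -/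
def CopsCanCatch (X : Type*) [MetricSpace X] (k : ℕ) : Prop :=
  ∀ τ : ℕ → ℝ, IsAgility τ → ∀ (r₀ : X) (c₀ : Fin k → X),
    ∃ q : CopStrategy X k τ, ∀ (r : ℕ → X) (c : ℕ → Fin k → X),
      r 0 = r₀ → c 0 = c₀ → IsPlay q r c → ∃ n, 1 ≤ n ∧ ∃ i, c n i = r n

/-- The strong cop number `c₀(X)`: the minimum `k ≥ 1` such that `k` cops can always catch the
robber on `X`, and `∞` if there is no such `k`. -/
noncomputable def strongCopNumber (X : Type*) [MetricSpace X] : ℕ∞ :=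
  ⨅ (k : ℕ) (_ : 1 ≤ k ∧ CopsCanCatch X k), (k : ℕ∞)

/-- The flat torus `Tⁿ = S¹ × ⋯ × S¹`, where `S¹ = ℝ / ℤ` carries its arc length distance and the
product carries the `ℓ²` product distance. This is the intrinsic distance of the
quotient of Euclidean `ℝⁿ` by the integer translations. -/
abbrev FlatTorus (n : ℕ) : Type := PiLp 2 (fun _ : Fin n => UnitAddCircle)

end CopsRobber

namespace CopsRobber

open scoped RealInnerProductSpace

/-! Lower bound: lift the vectors from the robber to at most `n` cops to shortest vectors of `ℝⁿ`.
Some unit `u` has nonpositive inner product with all of them (`exists_unit_inner_nonpos`), and a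
short step along `u` leaves every cop out of reach (`lt_norm_toTorus_sub`). Upper bound: lifts need
not be shortest. Adding large lattice vectors, `n + 1` initial differences get lifts `v i` that span
positively (`exists_positively_spanning_lifts`). Cop `i` always stays a multiple `d • v i`, `d ≥ 0`,
behind the robber. Each cop copies the robber's move `w`; one for which `w` points sufficiently
against `v i` can also advance along `v i` (`norm_add_smul_le`), and there is always such a cop. So
the total lag drops by at least `ε * t` per step of length `t` until a capture, and the step lengths
have infinite sum. -/

/-! ### Reduction of the game to single steps. -/

/-- A sequence can be defined by prescribing each term as a function of all the previous ones. -/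
theorem exists_seq_of_history {S : Type*} (s₀ : S) (F : ∀ n : ℕ, (Fin (n + 1) → S) → S) :
    ∃ p : ℕ → S, p 0 = s₀ ∧ ∀ n, p (n + 1) = F n (fun j => p j) := by
  let G : ∀ n : ℕ, (∀ m, m < n → S) → S := fun n =>
    match n with
    | 0 => fun _ => s₀
    | n + 1 => fun ih => F n (fun j => ih j j.isLt)
  refine ⟨fun n => Nat.lt_wfRel.wf.fix G n, ?_, fun n => ?_⟩
  · exact WellFounded.fix_eq _ _ _
  · exact WellFounded.fix_eq _ _ _

/-- If the robber can always move so that afterwards no cop can reach him, then he is never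
caught. -/
theorem not_copsCanCatch_of_escape {X : Type*} [MetricSpace X] {k : ℕ} {t : ℝ} (ht : 0 < t)
    {r₀ : X} {c₀ : Fin k → X} (h₀ : ∀ i, c₀ i ≠ r₀)
    (escape : ∀ (r : X) (c : Fin k → X), (∀ i, c i ≠ r) →
      ∃ r', dist r r' ≤ t ∧ ∀ i, t < dist (c i) r') : ¬ CopsCanCatch X k := by
  classical
  intro h
  have hτ : IsAgility (fun _ => t) := by
    refine ⟨fun _ => ht, ?_⟩
    simp only [Finset.sum_const, Finset.card_range, nsmul_eq_mul]
    exact tendsto_natCast_atTop_atTop.atTop_mul_const ht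
  obtain ⟨q, hq⟩ := h _ hτ r₀ c₀
  choose! g hg₁ hg₂ using escape
  obtain ⟨p, hp₀, hp⟩ := exists_seq_of_history (r₀, c₀) fun n H =>
    (g (H (Fin.last n)).1 (H (Fin.last n)).2,
      q.move n (Fin.snoc (α := fun _ => X) (fun j => (H j).1)
        (g (H (Fin.last n)).1 (H (Fin.last n)).2)) (fun j => (H j).2))
  have hr : ∀ n, (p (n + 1)).1 = g (p n).1 (p n).2 := fun n => by simp [hp n]
  have hc : ∀ n, (p (n + 1)).2 =
      q.move n (fun j : Fin (n + 2) => (p j).1) (fun j : Fin (n + 1) => (p j).2) := by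
    intro n
    have : (fun j : Fin (n + 2) => (p j).1) = Fin.snoc (α := fun _ => X)
        (fun j : Fin (n + 1) => (p j).1) (g (p n).1 (p n).2) := by
      funext j
      refine Fin.lastCases ?_ (fun j => ?_) j
      · simp [hr]
      · simp
    rw [this]
    simp [hp n]
  have free : ∀ n i, (p n).2 i ≠ (p n).1 := by
    intro n
    induction n with
    | zero => simpa [hp₀] using h₀
    | succ n ih =>
      intro i hi
      have h₁ := hg₂ _ _ ih i
      have h₂ := q.dist_move_le n (fun j : Fin (n + 2) => (p j).1)
        (fun j : Fin (n + 1) => (p j).2) i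
      rw [← hc, hi, hr] at h₂
      simp only [Fin.val_last] at h₂
      exact absurd h₁ (not_lt.2 h₂)
  obtain ⟨n, -, i, hi⟩ := hq (fun n => (p n).1) (fun n => (p n).2) (by simp [hp₀]) (by simp [hp₀])
    ⟨fun n => by rw [hr]; exact hg₁ _ _ (free n), hc⟩
  exact free n i hi

/-- If the cops can keep an invariant and, in a step of length `τ`, either catch the robber or
decrease a nonnegative potential by a fixed multiple of `τ`, then they catch the robber. -/
theorem exists_strategy_of_potential {X : Type*} [MetricSpace X] {k : ℕ} {τ : ℕ → ℝ}
    (hτ : IsAgility τ) {r₀ : X} {c₀ : Fin k → X} {ε : ℝ} (hε : 0 < ε)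
    (Inv : X → (Fin k → X) → Prop) (Φ : X → (Fin k → X) → ℝ) (h₀ : Inv r₀ c₀)
    (nonneg : ∀ r c, Inv r c → 0 ≤ Φ r c)
    (step : ∀ t, 0 < t → ∀ r r' c, Inv r c → dist r r' ≤ t → ∃ c' : Fin k → X,
      (∀ i, dist (c i) (c' i) ≤ t) ∧ Inv r' c' ∧
        ((∃ i, c' i = r') ∨ Φ r' c' ≤ Φ r c - ε * t)) :
    ∃ q : CopStrategy X k τ, ∀ (r : ℕ → X) (c : ℕ → Fin k → X),
      r 0 = r₀ → c 0 = c₀ → IsPlay q r c → ∃ n, 1 ≤ n ∧ ∃ i, c n i = r n := by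
  classical
  -- A strategy must be legal on every history, so legality is kept apart from the invariant; where
  -- the hypotheses fail, the cops stay put.
  have key : ∀ (t : ℝ) (r r' : X) (c : Fin k → X), ∃ c' : Fin k → X, 0 < t →
      (∀ i, dist (c i) (c' i) ≤ t) ∧ (Inv r c → dist r r' ≤ t → Inv r' c' ∧
        ((∃ i, c' i = r') ∨ Φ r' c' ≤ Φ r c - ε * t)) := by
    intro t r r' c
    by_cases h : 0 < t ∧ Inv r c ∧ dist r r' ≤ t
    · obtain ⟨c', h₁, h₂⟩ := step t h.1 r r' c h.2.1 h.2.2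
      exact ⟨c', fun _ => ⟨h₁, fun _ _ => h₂⟩⟩
    · exact ⟨c, fun ht => ⟨fun i => by simpa using ht.le, fun h₁ h₂ => absurd ⟨ht, h₁, h₂⟩ h⟩⟩
  choose f hf using key
  refine ⟨⟨fun n r c => f (τ n) (r (Fin.last n).castSucc) (r (Fin.last (n + 1))) (c (Fin.last n)),
    fun n r c i => (hf _ _ _ _ (hτ.pos n)).1 i⟩, fun r c hr hc play => ?_⟩
  have hstep : ∀ n, Inv (r n) (c n) → Inv (r (n + 1)) (c (n + 1)) ∧
      ((∃ i, c (n + 1) i = r (n + 1)) ∨ Φ (r (n + 1)) (c (n + 1)) ≤ Φ (r n) (c n) - ε * τ n) := by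
    intro n hn
    have h₁ := (hf (τ n) (r n) (r (n + 1)) (c n) (hτ.pos n)).2 hn (play.robber_legal n)
    have h₂ := play.cops_follow n
    simp only [Fin.val_castSucc, Fin.val_last] at h₂
    rwa [← h₂] at h₁
  have hInv : ∀ n, Inv (r n) (c n) := by
    intro n
    induction n with
    | zero => rwa [hr, hc]
    | succ n ih => exact (hstep n ih).1
  by_contra! hfree
  have hdec : ∀ N, Φ (r N) (c N) ≤ Φ (r 0) (c 0) - ε * ∑ n ∈ Finset.range N, τ n := by
    intro N
    induction N with
    | zero => simp
    | succ N ih =>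
      rcases (hstep N (hInv N)).2 with ⟨i, hi⟩ | h
      · exact absurd hi (hfree _ (by omega) i)
      · rw [Finset.sum_range_succ]
        linarith
  obtain ⟨N, hN⟩ := (hτ.tendsto_sum.eventually_gt_atTop (Φ (r 0) (c 0) / ε)).exists
  rw [div_lt_iff₀ hε] at hN
  linarith [hdec N, nonneg _ _ (hInv N)]

/-! ### Lifting from the torus to Euclidean space. -/

/-- The covering map from Euclidean space to the flat torus. -/
noncomputable def toTorus (n : ℕ) : EuclideanSpace ℝ (Fin n) →+ FlatTorus n where
  toFun w := WithLp.toLp 2 fun j => (w j : UnitAddCircle)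
  map_zero' := by ext j; simp
  map_add' x y := by ext j; simp

@[simp]
theorem toTorus_apply {n : ℕ} (w : EuclideanSpace ℝ (Fin n)) (j : Fin n) :
    toTorus n w j = (w j : UnitAddCircle) := rfl

theorem continuous_toTorus (n : ℕ) : Continuous (toTorus n) := by
  refine (PiLp.continuous_toLp 2 _).comp (continuous_pi fun j => ?_)
  exact (AddCircle.continuous_mk' 1).comp (by fun_prop)

theorem norm_toTorus_le {n : ℕ} (w : EuclideanSpace ℝ (Fin n)) : ‖toTorus n w‖ ≤ ‖w‖ := by
  rw [EuclideanSpace.norm_eq, PiLp.norm_eq_of_L2]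
  gcongr with j
  rw [toTorus_apply, UnitAddCircle.norm_eq]
  exact (round_le (w j) 0).trans (by simp)

/-- Every point of the torus has a lift of the same norm. -/
theorem exists_toTorus_eq {n : ℕ} (x : FlatTorus n) :
    ∃ w : EuclideanSpace ℝ (Fin n), toTorus n w = x ∧ ‖w‖ = ‖x‖ := by
  have h : ∀ j, ∃ a : ℝ, (a : UnitAddCircle) = x j ∧ ‖a‖ = ‖x j‖ := by
    intro j
    obtain ⟨b, hb⟩ := QuotientAddGroup.mk_surjective (x j)
    change (b : UnitAddCircle) = x j at hb
    refine ⟨b - round b, ?_, ?_⟩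
    · rw [← hb]
      rw [AddCircle.coe_sub, sub_eq_self]
      exact (AddCircle.coe_eq_zero_iff (1 : ℝ)).2 ⟨round b, by simp⟩
    · rw [← hb, UnitAddCircle.norm_eq, Real.norm_eq_abs]
  choose a ha hn using h
  refine ⟨WithLp.toLp 2 a, ?_, ?_⟩
  · ext j
    simp [ha]
  · rw [EuclideanSpace.norm_eq, PiLp.norm_eq_of_L2]
    simp [hn]

theorem toTorus_eq_zero_iff {n : ℕ} {w : EuclideanSpace ℝ (Fin n)} :
    toTorus n w = 0 ↔ ∀ j, ∃ m : ℤ, (m : ℝ) = w j := by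
  constructor
  · intro h j
    have := congrArg (fun x : FlatTorus n => x j) h
    obtain ⟨m, hm⟩ := (AddCircle.coe_eq_zero_iff (1 : ℝ)).1 this
    exact ⟨m, by simpa using hm⟩
  · intro h
    ext j
    obtain ⟨m, hm⟩ := h j
    exact (AddCircle.coe_eq_zero_iff (1 : ℝ)).2 ⟨m, by simpa using hm⟩

theorem one_le_norm_of_toTorus_eq_zero {n : ℕ} {w : EuclideanSpace ℝ (Fin n)}
    (h : toTorus n w = 0) (hw : w ≠ 0) : 1 ≤ ‖w‖ := by
  obtain ⟨j, hj⟩ : ∃ j, w j ≠ 0 := by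
    by_contra! h
    exact hw (by ext j; simpa using h j)
  obtain ⟨m, hm⟩ := toTorus_eq_zero_iff.1 h j
  have hm₀ : m ≠ 0 := by
    rintro rfl
    exact hj (by simpa using hm.symm)
  calc (1 : ℝ) ≤ |(m : ℝ)| := by exact_mod_cast Int.one_le_abs hm₀
    _ = ‖w j‖ := by rw [hm, Real.norm_eq_abs]
    _ ≤ ‖w‖ := PiLp.norm_apply_le w j

/-! ### Escape from at most `n` cops. -/

/-- At most `n` vectors of `n`-dimensional Euclidean space lie in a common closed half-space. -/
theorem exists_unit_inner_nonpos {n k : ℕ} (hn : 1 ≤ n) (hk : k ≤ n)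
    (v : Fin k → EuclideanSpace ℝ (Fin n)) :
    ∃ u : EuclideanSpace ℝ (Fin n), ‖u‖ = 1 ∧ ∀ i, ⟪v i, u⟫ ≤ 0 := by
  suffices h : ∃ u : EuclideanSpace ℝ (Fin n), u ≠ 0 ∧ ∀ i, ⟪v i, u⟫ ≤ 0 by
    obtain ⟨u, hu, h⟩ := h
    refine ⟨‖u‖⁻¹ • u, norm_smul_inv_norm hu, fun i => ?_⟩
    rw [inner_smul_right]
    exact mul_nonpos_of_nonneg_of_nonpos (by positivity) (h i)
  let L : EuclideanSpace ℝ (Fin n) →ₗ[ℝ] (Fin k → ℝ) :=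
    LinearMap.pi fun i => (innerSL ℝ (v i)).toLinearMap
  have hL : ∀ u i, L u i = ⟪v i, u⟫ := fun u i => rfl
  -- Injectivity forces `k = n`, so all inner products can be prescribed as `-1`; otherwise a kernel
  -- vector is orthogonal to every `v i`.
  by_cases hinj : Function.Injective L
  · have hnk := LinearMap.finrank_le_finrank_of_injective hinj
    simp only [finrank_euclideanSpace, Fintype.card_fin, Module.finrank_fin_fun] at hnk
    have hsurj : Function.Surjective L :=
      (LinearMap.injective_iff_surjective_of_finrank_eq_finrank
        (by simp; omega)).1 hinj
    obtain ⟨u, hu⟩ := hsurj fun _ => -1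
    refine ⟨u, ?_, fun i => ?_⟩
    · rintro rfl
      have := congrFun hu ⟨0, by omega⟩
      simp at this
    · rw [← hL, hu]
      norm_num
  · rw [← LinearMap.ker_eq_bot, Submodule.eq_bot_iff] at hinj
    push Not at hinj
    obtain ⟨u, hu, hu₀⟩ := hinj
    refine ⟨u, hu₀, fun i => ?_⟩
    rw [← hL, LinearMap.mem_ker.1 hu]
    simp

/-- Let `y` be a shortest lift of the new difference. If `y = v - t • u`, then `‖y‖² ≥ ‖v‖² + t²`.
Otherwise they differ by a lattice vector of norm at least `1`, and minimality of `v` gives `1 ≤ 2 *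
(‖y‖ + t)`, so `‖y‖ > t` because `t < 1 / 4`. -/
theorem lt_norm_toTorus_sub {n : ℕ} {v u : EuclideanSpace ℝ (Fin n)} (hv : v ≠ 0)
    (hmin : ‖v‖ = ‖toTorus n v‖) (hu : ‖u‖ = 1) (huv : ⟪v, u⟫ ≤ 0) {t : ℝ} (ht : 0 < t)
    (ht4 : t < 1 / 4) : t < ‖toTorus n (v - t • u)‖ := by
  obtain ⟨y, hy, hyn⟩ := exists_toTorus_eq (toTorus n (v - t • u))
  rw [← hyn]
  have htu : ‖t • u‖ = t := by rw [norm_smul, hu, Real.norm_of_nonneg ht.le, mul_one]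
  have hz : toTorus n (y - (v - t • u)) = 0 := by rw [map_sub, hy, sub_self]
  by_cases h : y - (v - t • u) = 0
  · rw [sub_eq_zero.1 h]
    refine lt_of_pow_lt_pow_left₀ 2 (norm_nonneg _) ?_
    rw [norm_sub_sq_real, htu, inner_smul_right]
    have : 0 < ‖v‖ := norm_pos_iff.2 hv
    nlinarith [mul_nonneg ht.le (neg_nonneg.2 huv)]
  · have h₁ := one_le_norm_of_toTorus_eq_zero hz h
    have h₂ : ‖v‖ ≤ ‖y + t • u‖ := by
      rw [hmin]
      have : toTorus n v = toTorus n (y + t • u) := by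
        rw [map_add, hy, ← map_add, sub_add_cancel]
      rw [this]
      exact norm_toTorus_le _
    have h₃ : ‖y - (v - t • u)‖ ≤ ‖y + t • u‖ + ‖v‖ := by
      have : y - (v - t • u) = (y + t • u) - v := by abel
      rw [this]
      exact norm_sub_le _ _
    have h₄ := norm_add_le y (t • u)
    linarith

/-- At most `n` cops cannot catch the robber on the `n`-dimensional flat torus. -/
theorem not_copsCanCatch_flatTorus {n k : ℕ} (hn : 1 ≤ n) (hk : k ≤ n) :
    ¬ CopsCanCatch (FlatTorus n) k := by
  have hne : toTorus n (EuclideanSpace.single ⟨0, hn⟩ (1 / 2)) ≠ 0 := by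
    intro h
    obtain ⟨m, hm⟩ := toTorus_eq_zero_iff.1 h ⟨0, hn⟩
    simp only [PiLp.single_apply, if_true] at hm
    have : (2 * m : ℤ) = 1 := by
      have : (2 * m : ℝ) = 1 := by rw [hm]; norm_num
      exact_mod_cast this
    omega
  refine not_copsCanCatch_of_escape (t := 1 / 8) (by norm_num)
    (r₀ := (0 : FlatTorus n)) (c₀ := fun _ => toTorus n (EuclideanSpace.single ⟨0, hn⟩ (1 / 2)))
    (fun _ => hne) fun r c hc => ?_
  choose v hv hvn using fun i => exists_toTorus_eq (c i - r)
  obtain ⟨u, hu, huv⟩ := exists_unit_inner_nonpos hn hk v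
  refine ⟨r + toTorus n ((1 / 8 : ℝ) • u), ?_, fun i => ?_⟩
  · rw [dist_self_add_right]
    refine (norm_toTorus_le _).trans ?_
    rw [norm_smul, hu]
    norm_num
  · have hv₀ : v i ≠ 0 := by
      intro h
      have := hv i
      rw [h, map_zero] at this
      exact hc i (sub_eq_zero.1 this.symm)
    have := lt_norm_toTorus_sub hv₀ (by rw [hvn, hv]) hu (huv i) (t := 1 / 8) (by norm_num)
      (by norm_num)
    rwa [map_sub, hv, sub_sub, ← dist_eq_norm] at this

/-! ### Positively spanning lifts. -/

/-- The vectors `-(1, …, 1), e₁, …, eₙ`. -/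
noncomputable def simplexVec (n : ℕ) : Fin (n + 1) → EuclideanSpace ℝ (Fin n) :=
  Fin.cons (-∑ j, EuclideanSpace.single j 1) fun j => EuclideanSpace.single j 1

theorem toTorus_nsmul_simplexVec {n : ℕ} (N : ℕ) (i : Fin (n + 1)) :
    toTorus n ((N : ℝ) • simplexVec n i) = 0 := by
  rw [Nat.cast_smul_eq_nsmul, map_nsmul]
  have hs : ∀ j : Fin n, toTorus n (EuclideanSpace.single j 1) = 0 := by
    intro j
    refine toTorus_eq_zero_iff.2 fun l => ?_
    by_cases h : l = j
    · exact ⟨1, by simp [h]⟩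
    · exact ⟨0, by simp [h]⟩
  refine Fin.cases ?_ (fun j => ?_) i
  · simp [simplexVec, hs]
  · simp [simplexVec, hs]

/-- The vectors `simplexVec n` span positively, in a quantitative form. -/
theorem exists_norm_le_neg_inner_simplexVec {n : ℕ} (hn : 1 ≤ n)
    (w : EuclideanSpace ℝ (Fin n)) : ∃ i, ‖w‖ ≤ (n : ℝ) ^ 2 * -⟪w, simplexVec n i⟫ := by
  by_contra! h
  -- With `m = ‖w‖ / n²`, all coordinates exceed `-m` and their sum is below `m`, so each is below
  -- `n * m`; then the `ℓ¹` norm is below `n² * m = ‖w‖`.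
  have hn₀ : (1 : ℝ) ≤ n := by exact_mod_cast hn
  set m := ‖w‖ / (n : ℝ) ^ 2 with hm
  have hm₀ : 0 ≤ m := by positivity
  have hwm : ‖w‖ = (n : ℝ) ^ 2 * m := by rw [hm]; field_simp
  have h' : ∀ i, -⟪w, simplexVec n i⟫ < m := by
    intro i
    rw [hm, lt_div_iff₀ (by positivity), mul_comm]
    exact h i
  have hlow : ∀ j, -m < w j := by
    intro j
    have := h' j.succ
    simp only [simplexVec, Fin.cons_succ, EuclideanSpace.inner_single_right] at this
    simp at this
    linarith
  have hsum : ∑ j, w j < m := by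
    have := h' 0
    simp only [simplexVec, Fin.cons_zero, inner_neg_right, inner_sum,
      EuclideanSpace.inner_single_right] at this
    simpa using this
  have habs : ∀ j, |w j| < n * m := by
    intro j
    rw [abs_lt]
    constructor
    · nlinarith [hlow j]
    · have h₁ : ∑ l ∈ Finset.univ.erase j, (-m) ≤ ∑ l ∈ Finset.univ.erase j, w l :=
        Finset.sum_le_sum fun l _ => (hlow l).le
      rw [Finset.sum_const, Finset.card_erase_of_mem (Finset.mem_univ j), Finset.card_univ,
        Fintype.card_fin, nsmul_eq_mul, Nat.cast_sub hn] at h₁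
      have h₂ := Finset.add_sum_erase Finset.univ (fun l => w l) (Finset.mem_univ j)
      simp only at h₂
      push_cast at h₁
      linarith
  have hle : ‖w‖ ≤ ∑ j, |w j| := by
    rw [EuclideanSpace.norm_eq]
    refine Real.sqrt_le_iff.2 ⟨Finset.sum_nonneg fun _ _ => abs_nonneg _, ?_⟩
    simpa using Finset.sum_sq_le_sq_sum_of_nonneg (s := Finset.univ) (f := fun j => |w j|)
      fun _ _ => abs_nonneg _
  have hlt : ∑ j, |w j| < ∑ _j : Fin n, n * m :=
    Finset.sum_lt_sum_of_nonempty ⟨⟨0, hn⟩, Finset.mem_univ _⟩ fun j _ => habs j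
  simp only [Finset.sum_const, Finset.card_univ, Fintype.card_fin, nsmul_eq_mul] at hlt
  nlinarith

/-- Any `n + 1` points of the torus have lifts that span positively. -/
theorem exists_positively_spanning_lifts {n : ℕ} (hn : 1 ≤ n) (x : Fin (n + 1) → FlatTorus n) :
    ∃ v : Fin (n + 1) → EuclideanSpace ℝ (Fin n), (∀ i, toTorus n (v i) = x i) ∧
      ∀ w, ∃ i, ‖w‖ ≤ -⟪w, v i⟫ := by
  choose e he _ using fun i => exists_toTorus_eq (x i)
  have hn₀ : (0 : ℝ) < n := by exact_mod_cast hn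
  -- The simplex part contributes at least `N * ‖w‖ / n²`, which covers the loss `‖w‖ * ∑ ‖e i‖` and
  -- leaves `‖w‖`.
  obtain ⟨N, hN⟩ := exists_nat_ge ((n : ℝ) ^ 2 * (∑ i, ‖e i‖ + 1))
  refine ⟨fun i => (N : ℝ) • simplexVec n i + e i, fun i => ?_, fun w => ?_⟩
  · rw [map_add, toTorus_nsmul_simplexVec, zero_add, he]
  · obtain ⟨i, hi⟩ := exists_norm_le_neg_inner_simplexVec hn w
    refine ⟨i, ?_⟩
    rw [inner_add_right, inner_smul_right]
    have h₁ : ⟪w, e i⟫ ≤ ‖w‖ * ∑ i, ‖e i‖ :=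
      (real_inner_le_norm _ _).trans (mul_le_mul_of_nonneg_left
        (Finset.single_le_sum (f := fun i => ‖e i‖) (fun _ _ => norm_nonneg _)
          (Finset.mem_univ i)) (norm_nonneg _))
    have h₂ : 0 ≤ -⟪w, simplexVec n i⟫ := by
      have := (norm_nonneg w).trans hi
      exact nonneg_of_mul_nonneg_right this (by positivity)
    have h₃ := mul_le_mul_of_nonneg_right hN h₂
    have h₄ : 0 ≤ ∑ i, ‖e i‖ + 1 := by positivity
    have h₅ := mul_le_mul_of_nonneg_left hi h₄
    nlinarith

/-! ### Pursuit by `n + 1` cops. -/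

/-- If `w` is a move of length at most `t` with a component against `v` of size at least `‖w‖`,
then adding a sufficiently small multiple of `v` to `w` again gives a move of length at most `t`. -/
theorem norm_add_smul_le {E : Type*} [NormedAddCommGroup E] [InnerProductSpace ℝ E] {w v : E}
    {t ε s : ℝ} (hwt : ‖w‖ ≤ t) (hwv : ‖w‖ ≤ -⟪w, v⟫) (hεv : ε * ‖v‖ ^ 2 ≤ 1)
    (hε1 : ε ≤ 1) (hs : 0 ≤ s) (hst : s ≤ ε * t) : ‖w + s • v‖ ≤ t := by
  have ht : 0 ≤ t := (norm_nonneg w).trans hwt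
  have hsle : s ≤ t := hst.trans (by nlinarith)
  refine le_of_sq_le_sq ?_ ht
  rw [norm_add_sq_real, inner_smul_right, norm_smul, Real.norm_of_nonneg hs]
  have h₁ : s * ‖w‖ ≤ s * -⟪w, v⟫ := mul_le_mul_of_nonneg_left hwv hs
  have h₂ : (s * ‖v‖) ^ 2 ≤ s * t :=
    calc (s * ‖v‖) ^ 2 = s * (s * ‖v‖ ^ 2) := by ring
      _ ≤ s * (ε * t * ‖v‖ ^ 2) := by gcongr
      _ = s * t * (ε * ‖v‖ ^ 2) := by ring
      _ ≤ s * t := mul_le_of_le_one_right (by positivity) hεv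
  have h₃ : 0 ≤ (t - ‖w‖) * (t + ‖w‖ - s) :=
    mul_nonneg (by linarith) (by linarith [norm_nonneg w])
  have h₄ : 0 ≤ s * ‖w‖ := by positivity
  nlinarith

/-- The least `d ≥ 0` such that the cop at `c` is displaced by `d • v` from the robber at `r`. -/
noncomputable def lag {n : ℕ} (v : EuclideanSpace ℝ (Fin n)) (r c : FlatTorus n) : ℝ :=
  sInf {d | 0 ≤ d ∧ c + toTorus n (d • v) = r}

section lag

variable {n : ℕ} {v : EuclideanSpace ℝ (Fin n)} {r c : FlatTorus n} {d : ℝ}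

theorem bddBelow_lag : BddBelow {d : ℝ | 0 ≤ d ∧ c + toTorus n (d • v) = r} := ⟨0, fun _ h => h.1⟩

theorem lag_le (hd : 0 ≤ d) (h : c + toTorus n (d • v) = r) : lag v r c ≤ d :=
  csInf_le bddBelow_lag ⟨hd, h⟩

/-- The admissible `d` form a closed set, so the infimum is attained. This makes the lag a function
of the current positions alone, as the potential requires. -/
theorem lag_spec (hd : 0 ≤ d) (h : c + toTorus n (d • v) = r) :
    0 ≤ lag v r c ∧ c + toTorus n (lag v r c • v) = r := by
  have hcl : IsClosed {d : ℝ | 0 ≤ d ∧ c + toTorus n (d • v) = r} := by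
    refine (isClosed_le continuous_const continuous_id).inter (isClosed_eq ?_ continuous_const)
    exact continuous_const.add ((continuous_toTorus n).comp (continuous_id.smul continuous_const))
  exact hcl.csInf_mem ⟨d, hd, h⟩ bddBelow_lag

end lag

/-- On the `n`-dimensional flat torus `n + 1` cops can always catch the robber. -/
theorem copsCanCatch_flatTorus {n : ℕ} (hn : 1 ≤ n) : CopsCanCatch (FlatTorus n) (n + 1) := by
  intro τ hτ r₀ c₀
  obtain ⟨v, hv, hspan⟩ := exists_positively_spanning_lifts hn fun i => r₀ - c₀ i
  obtain ⟨ε, hε, hε1, hεv⟩ : ∃ ε : ℝ, 0 < ε ∧ ε ≤ 1 ∧ ∀ i, ε * ‖v i‖ ^ 2 ≤ 1 := by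
    have hV : 0 ≤ ∑ i, ‖v i‖ ^ 2 := Finset.sum_nonneg fun _ _ => sq_nonneg _
    refine ⟨(∑ i, ‖v i‖ ^ 2 + 1)⁻¹, by positivity, inv_le_one_of_one_le₀ (by linarith),
      fun i => ?_⟩
    rw [inv_mul_le_iff₀ (by positivity), mul_one]
    exact (Finset.single_le_sum (f := fun i => ‖v i‖ ^ 2) (fun _ _ => sq_nonneg _)
      (Finset.mem_univ i)).trans (by linarith)
  refine exists_strategy_of_potential hτ hε
    (fun r c => ∀ i, ∃ d : ℝ, 0 ≤ d ∧ c i + toTorus n (d • v i) = r)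
    (fun r c => ∑ i, lag (v i) r (c i)) (fun i => ⟨1, zero_le_one, by simp [hv]⟩)
    (fun r c h => Finset.sum_nonneg fun i _ => ?_) fun t ht r r' c h hrr' => ?_
  · obtain ⟨d, hd, hdc⟩ := h i
    exact (lag_spec hd hdc).1
  obtain ⟨d, hd⟩ : ∃ d : Fin (n + 1) → ℝ, ∀ i, lag (v i) r (c i) = d i := ⟨_, fun _ => rfl⟩
  have hspec : ∀ i, 0 ≤ d i ∧ c i + toTorus n (d i • v i) = r := by
    intro i
    obtain ⟨_, h₁, h₂⟩ := h i
    rw [← hd]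
    exact lag_spec h₁ h₂
  obtain ⟨w, hw, hwn⟩ := exists_toTorus_eq (r' - r)
  have hwt : ‖w‖ ≤ t := by rwa [hwn, ← dist_eq_norm, dist_comm]
  -- The advance along `v i` is capped at `d i`, so that a cop lands exactly on the robber instead
  -- of overshooting.
  obtain ⟨s, hs⟩ : ∃ s : Fin (n + 1) → ℝ, ∀ i,
      s i = if ‖w‖ ≤ -⟪w, v i⟫ then min (d i) (ε * t) else 0 := ⟨_, fun _ => rfl⟩
  have hs₀ : ∀ i, 0 ≤ s i := by
    intro i
    rw [hs]
    split_ifs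
    · exact le_min (hspec i).1 (mul_pos hε ht).le
    · rfl
  have hsd : ∀ i, s i ≤ d i := by
    intro i
    rw [hs]
    split_ifs
    · exact min_le_left _ _
    · exact (hspec i).1
  have hnew : ∀ i, c i + toTorus n (w + s i • v i) + toTorus n ((d i - s i) • v i) = r' := by
    intro i
    have h₁ : w + s i • v i + (d i - s i) • v i = d i • v i + w := by module
    rw [add_assoc, ← map_add, h₁, map_add, ← add_assoc, (hspec i).2, hw, add_sub_cancel]
  refine ⟨fun i => c i + toTorus n (w + s i • v i), fun i => ?_,
    fun i => ⟨_, sub_nonneg.2 (hsd i), hnew i⟩, ?_⟩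
  · rw [dist_self_add_right]
    refine (norm_toTorus_le _).trans ?_
    by_cases hi : ‖w‖ ≤ -⟪w, v i⟫
    · refine norm_add_smul_le hwt hi (hεv i) hε1 (hs₀ i) ?_
      rw [hs, if_pos hi]
      exact min_le_right _ _
    · rwa [hs, if_neg hi, zero_smul, add_zero]
  · obtain ⟨i, hi⟩ := hspan w
    have hsi : s i = min (d i) (ε * t) := by rw [hs, if_pos hi]
    -- If the cap is active, cop `i` captures; otherwise it gains `ε * t` while no other lag grows.
    rcases le_total (d i) (ε * t) with hle | hle
    · left
      refine ⟨i, ?_⟩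
      have h₁ : d i - s i = 0 := by rw [hsi, min_eq_left hle, sub_self]
      have h₂ := hnew i
      rwa [h₁, zero_smul, map_zero, add_zero] at h₂
    · right
      have h₁ : ∑ l, lag (v l) r' (c l + toTorus n (w + s l • v l)) ≤ ∑ l, (d l - s l) :=
        Finset.sum_le_sum fun l _ => lag_le (sub_nonneg.2 (hsd l)) (hnew l)
      have h₂ := Finset.single_le_sum (fun l _ => hs₀ l) (Finset.mem_univ i)
      rw [hsi, min_eq_right hle] at h₂
      rw [Finset.sum_sub_distrib] at h₁
      simp only [hd]
      linarith

end CopsRobber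

theorem mainTheorem5 (n : ℕ) (hn : 1 ≤ n) :
    CopsRobber.strongCopNumber (CopsRobber.FlatTorus n) = ((n + 1 : ℕ) : ℕ∞) := by
  refine le_antisymm (iInf₂_le _ ⟨by omega, CopsRobber.copsCanCatch_flatTorus hn⟩)
    (le_iInf₂ fun k hk => ?_)
  have : n + 1 ≤ k := by
    by_contra! h
    exact CopsRobber.not_copsCanCatch_flatTorus hn (by omega) hk.2
  exact_mod_cast this
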